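/- Let $\mathcal H\neq\{0\}$ be a separable complex Hilbert space, $\mathcal L(\mathcal H)$ its bounded operators, $\mathcal S(\mathcal H)$ the set of states (positive operators $\rho$ with $\operatorname{tr}\rho=1$), and call $E\in\mathcal L(\mathcal H)$ with $0\le E\le I$ an effect. A POVM (measurement) on a standard Borel space $(\Omega,\mathcal B(\Omega))$ is a map $M:\mathcal B(\Omega)\to\mathcal L(\mathcal H)$ such that $X\mapsto\operatorname{tr}[\rho M(X)]$ is a probability measure for every $\rho\in\mathcal S(\mathcal H)$. Let $\mathcal O$ be the collection of all POVMs on standard Borel spaces, write $\Omega_M$ for the outcome space of $M$, and for $\mathcal M\subset\mathcal O$ let $E(\mathcal M)=\{M(X): M\in\mathcal M,\ X\in\mathcal B(\Omega_M)\}$. A state $\rho_0$ is faithful if $A\ge 0$ and $\operatorname{tr}[\rho_0A]=0$ imply $A=0$. Non-normal definition. Let $\mathcal M\subset\mathcal O$ be a set of measurements. $\mathcal M$ is contextuality non-confirming in the non-normal sense if there are a POVM $G$ on a standard Borel space $\Omega$, a faithful state $\rho_0$, and a positive linear map $T:\mathcal L(\mathcal H)\to L^\infty(\Omega,\operatorname{tr}[\rho_0G])$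 with $T(I)=1$ such that $$\operatorname{tr}[\rho M(X)]=\int_\Omega T(M(X))(\lambda)\,d\operatorname{tr}[\rho G(\lambda)]\qquad(\ast)$$ for all $M\in\mathcal M$, $\rho\in\mathcal S(\mathcal H)$ and $X\in\mathcal B(\Omega_M)$. A set of states $\mathcal S\subset\mathcal S(\mathcal H)$ is contextuality non-confirming in the non-normal sense if there are such $G,\rho_0,T$ for which $(\ast)$ holds for all $M\in\mathcal O$, $\rho\in\mathcal S$ and $X\in\mathcal B(\Omega_M)$. Approximate definition. $\mathcal M$ is approximately contextuality non-confirming if there is a POVM $G$ on a standard Borel space $\Omega$ such that for every $\varepsilon>0$ and every finite $\mathcal F\subset E(\mathcal M)$ there are a countable (possibly finite) measurable partition $(X_i)_i$ of $\Omega$ and states $(\sigma_i)_i$ such that the (dual) entanglement-breaking channel $$\Lambda^*(A)=\sum_i\operatorname{tr}[\sigma_iA]\,G(X_i)\quad\text{(ultraweakly convergent)},\qquad A\in\mathcal L(\mathcal H),$$ satisfies $|\operatorname{tr}[\rho(\Lambda^*(E)-E)]|<\varepsilon$ for all $E\in\mathcal F$ and all $\rho\in\mathcal S(\mathcal H)$.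 A set of states $\mathcal S$ is approximately contextuality non-confirming if there is a POVM $G$ on a standard Borel space such that for every $\varepsilon>0$ and every finite set $\mathcal F$ of effects there is a $\Lambda^*$ of this form (with $G$ fixed) satisfying $|\operatorname{tr}[\rho(\Lambda^*(E)-E)]|<\varepsilon$ for all $E\in\mathcal F$ and all $\rho\in\mathcal S$. Proposition. (i) A set of measurements $\mathcal M\subset\mathcal O$ is contextuality non-confirming in the non-normal sense if and only if it is approximately contextuality non-confirming. (ii) A set of states $\mathcal S\subset\mathcal S(\mathcal H)$ is contextuality non-confirming in the non-normal sense if and only if it is approximately contextuality non-confirming. -/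

import Mathlib

open MeasureTheory
open scoped InnerProductSpace ComplexOrder ENNReal

noncomputable section

namespace Contextuality

variable (H : Type*) [NormedAddCommGroup H] [InnerProductSpace ℂ H] [CompleteSpace H]

/-- The index set of a fixed orthonormal (Hilbert) basis of `H`. -/
def BasisIndex : Set H := Classical.choose (exists_hilbertBasis ℂ H)

/-- A fixed orthonormal (Hilbert) basis of `H`. -/
def basis : HilbertBasis (BasisIndex H) ℂ H :=
  Classical.choose (Classical.choose_spec (exists_hilbertBasis ℂ H))

variable {H}

/-- The trace `tr[A] = ∑ᵢ ⟨eᵢ, A eᵢ⟩`. It is only used for products `ρ A` of a density operator `ρ`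
and a bounded operator `A`; for these the series converges and its sum is the same in every
orthonormal basis, see `State.hasSum_trace`. -/
def trace (A : H →L[ℂ] H) : ℂ := ∑' i, ⟪basis H i, A (basis H i)⟫_ℂ

variable (H)

/-- A (normal) state: a density operator, that is a positive operator of trace one. -/
structure State where
  op : H →L[ℂ] H
  nonneg : 0 ≤ op
  hasSum_one : HasSum (fun i => ⟪basis H i, op (basis H i)⟫_ℂ) 1

variable {H}

/-! Independence of the trace of the orthonormal basis. -/

set_option linter.unusedSectionVars false in
theorem hasSum_norm_inner_sq {ν : Type*} (c : HilbertBasis ν ℂ H) (x : H) :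
    HasSum (fun j => ‖⟪c j, x⟫_ℂ‖ ^ 2) (‖x‖ ^ 2) := by
  have h := Complex.hasSum_re (c.hasSum_inner_mul_inner x x)
  convert h using 1
  · funext j
    rw [← inner_conj_symm x (c j), Complex.conj_mul']
    norm_cast
  · rw [inner_self_eq_norm_sq_to_K]
    norm_cast

theorem hilbertSchmidt_adjoint {ι κ : Type*} (b : HilbertBasis ι ℂ H) (e : HilbertBasis κ ℂ H)
    (T : H →L[ℂ] H) :
    ∑' i, ENNReal.ofReal (‖T (b i)‖ ^ 2) =
      ∑' j, ENNReal.ofReal (‖ContinuousLinearMap.adjoint T (e j)‖ ^ 2) := by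
  have h1 : ∀ i, ENNReal.ofReal (‖T (b i)‖ ^ 2) =
      ∑' j, ENNReal.ofReal (‖⟪e j, T (b i)⟫_ℂ‖ ^ 2) := fun i => by
    have h := hasSum_norm_inner_sq e (T (b i))
    rw [← h.tsum_eq, ENNReal.ofReal_tsum_of_nonneg (fun _ => by positivity) h.summable]
  have h2 : ∀ j, ENNReal.ofReal (‖ContinuousLinearMap.adjoint T (e j)‖ ^ 2) =
      ∑' i, ENNReal.ofReal (‖⟪b i, ContinuousLinearMap.adjoint T (e j)⟫_ℂ‖ ^ 2) := fun j => by
    have h := hasSum_norm_inner_sq b (ContinuousLinearMap.adjoint T (e j))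
    rw [← h.tsum_eq, ENNReal.ofReal_tsum_of_nonneg (fun _ => by positivity) h.summable]
  rw [tsum_congr h1, tsum_congr h2, ENNReal.tsum_comm]
  refine tsum_congr fun j => tsum_congr fun i => ?_
  rw [ContinuousLinearMap.adjoint_inner_right, norm_inner_symm]

theorem hasSum_inner_hilbertSchmidt {ι κ : Type*} (b : HilbertBasis ι ℂ H)
    (e : HilbertBasis κ ℂ H) (S R : H →L[ℂ] H)
    (hS : ∑' i, ENNReal.ofReal (‖S (b i)‖ ^ 2) ≠ ∞)
    (hR : ∑' i, ENNReal.ofReal (‖R (b i)‖ ^ 2) ≠ ∞) :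
    HasSum (fun i => ⟪S (b i), R (b i)⟫_ℂ)
      (∑' j, ⟪ContinuousLinearMap.adjoint R (e j), ContinuousLinearMap.adjoint S (e j)⟫_ℂ) ∧
    Summable fun j =>
      ⟪ContinuousLinearMap.adjoint R (e j), ContinuousLinearMap.adjoint S (e j)⟫_ℂ := by
  have bessel : ∀ T : H →L[ℂ] H, ∑' i, ENNReal.ofReal (‖T (b i)‖ ^ 2) ≠ ∞ →
      Summable fun p : ι × κ => ‖⟪e p.2, T (b p.1)⟫_ℂ‖ ^ 2 := by
    intro T hT
    have h1 : Summable fun i => ‖T (b i)‖ ^ 2 := by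
      have := ENNReal.summable_toReal hT
      refine this.congr fun i => ?_
      rw [ENNReal.toReal_ofReal (by positivity)]
    have h2 := fun i => hasSum_norm_inner_sq e (T (b i))
    rw [summable_prod_of_nonneg (fun _ => by positivity)]
    refine ⟨fun i => (h2 i).summable, ?_⟩
    exact h1.congr fun i => (h2 i).tsum_eq.symm
  have hsum : Summable fun p : ι × κ => ⟪S (b p.1), e p.2⟫_ℂ * ⟪e p.2, R (b p.1)⟫_ℂ := by
    refine Summable.of_norm_bounded ((bessel S hS).add (bessel R hR)) fun p => ?_
    rw [norm_mul, norm_inner_symm]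
    nlinarith [sq_nonneg (‖⟪e p.2, S (b p.1)⟫_ℂ‖ - ‖⟪e p.2, R (b p.1)⟫_ℂ‖),
      sq_nonneg (‖⟪e p.2, S (b p.1)⟫_ℂ‖), sq_nonneg (‖⟪e p.2, R (b p.1)⟫_ℂ‖)]
  have h1 := hsum.hasSum.prod_fiberwise fun i => e.hasSum_inner_mul_inner (S (b i)) (R (b i))
  have h2 := ((Equiv.prodComm κ ι).hasSum_iff.mpr hsum.hasSum).prod_fiberwise
    (g := fun j => ⟪ContinuousLinearMap.adjoint R (e j), ContinuousLinearMap.adjoint S (e j)⟫_ℂ)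
    fun j => by
      have := b.hasSum_inner_mul_inner (ContinuousLinearMap.adjoint R (e j))
        (ContinuousLinearMap.adjoint S (e j))
      refine Eq.mp (congrArg (fun f => HasSum f _) (funext fun i => ?_)) this
      simp only [Function.comp, Equiv.prodComm_apply, Prod.swap]
      rw [ContinuousLinearMap.adjoint_inner_left, ContinuousLinearMap.adjoint_inner_right, mul_comm]
  rw [h2.tsum_eq]
  exact ⟨h1, h2.summable⟩

/-- For a density operator `ρ` and a bounded operator `A`, the series for `tr[ρ A]` converges to
the same value in every orthonormal basis. -/
theorem State.hasSum_trace (ρ : State H) (A : H →L[ℂ] H) {κ : Type*} (e : HilbertBasis κ ℂ H) :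
    HasSum (fun j => ⟪e j, (ρ.op * A) (e j)⟫_ℂ) (trace (ρ.op * A)) := by
  obtain ⟨S, hSa, hSS⟩ : ∃ S : H →L[ℂ] H, ContinuousLinearMap.adjoint S = S ∧ S * S = ρ.op :=
    ⟨CFC.sqrt ρ.op, (CFC.sqrt_nonneg ρ.op).isSelfAdjoint, CFC.sqrt_mul_sqrt_self _ ρ.nonneg⟩
  have hin : ∀ x y : H, ⟪x, S y⟫_ℂ = ⟪S x, y⟫_ℂ := fun x y => by
    rw [← ContinuousLinearMap.adjoint_inner_left, hSa]
  have hfin : ∑' i, ENNReal.ofReal (‖S (basis H i)‖ ^ 2) ≠ ∞ := by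
    have h := Complex.hasSum_re ρ.hasSum_one
    have h' : HasSum (fun i => ‖S (basis H i)‖ ^ 2) 1 := by
      rw [Complex.one_re] at h
      convert h using 1
      funext i
      rw [← hSS, mul_apply_eq_comp, hin, inner_self_eq_norm_sq_to_K]
      norm_cast
    rw [← ENNReal.ofReal_tsum_of_nonneg (fun _ => by positivity) h'.summable]
    exact ENNReal.ofReal_ne_top
  have hfinAll : ∑' i, ENNReal.ofReal (‖S (e i)‖ ^ 2) ≠ ∞ := by
    rw [hilbertSchmidt_adjoint e (basis H), hSa]
    exact hfin
  have hadj : ContinuousLinearMap.adjoint (S * A) = ContinuousLinearMap.adjoint A * S := by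
    have h := ContinuousLinearMap.adjoint_comp S A
    rw [hSa] at h
    exact h
  have hfinA : ∑' i, ENNReal.ofReal (‖ContinuousLinearMap.adjoint (S * A) (basis H i)‖ ^ 2) ≠ ∞ := by
    rw [hadj]
    have hle : ∀ j, ENNReal.ofReal (‖(ContinuousLinearMap.adjoint A * S) (basis H j)‖ ^ 2) ≤
        ENNReal.ofReal (‖ContinuousLinearMap.adjoint A‖ ^ 2) *
          ENNReal.ofReal (‖S (basis H j)‖ ^ 2) := by
      intro j
      rw [← ENNReal.ofReal_mul (by positivity), ← mul_pow]
      refine ENNReal.ofReal_le_ofReal (pow_le_pow_left₀ (norm_nonneg _) ?_ 2)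
      exact (ContinuousLinearMap.adjoint A).le_opNorm _
    refine ne_top_of_le_ne_top ?_ (ENNReal.tsum_le_tsum hle)
    rw [ENNReal.tsum_mul_left]
    exact ENNReal.mul_ne_top ENNReal.ofReal_ne_top hfin
  have hfinR : ∑' i, ENNReal.ofReal (‖(S * A) (basis H i)‖ ^ 2) ≠ ∞ := by
    rw [hilbertSchmidt_adjoint (basis H) (basis H)]
    exact hfinA
  have hfinRe : ∑' i, ENNReal.ofReal (‖(S * A) (e i)‖ ^ 2) ≠ ∞ := by
    rw [hilbertSchmidt_adjoint e (basis H)]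
    exact hfinA
  have hterm : ∀ x : H, ⟪x, (ρ.op * A) x⟫_ℂ = ⟪S x, (S * A) x⟫_ℂ := fun x => by
    rw [← hSS, mul_apply_eq_comp, mul_apply_eq_comp, hin]
    rfl
  have hb := (hasSum_inner_hilbertSchmidt (basis H) (basis H) S (S * A) hfin hfinR).1
  simp_rw [hterm, trace, hterm]
  rw [hb.tsum_eq]
  exact (hasSum_inner_hilbertSchmidt e (basis H) S (S * A) hfinAll hfinRe).1

/-- A state `ρ` is faithful if `tr[ρ A] = 0` with `A ≥ 0` forces `A = 0`. -/
def State.Faithful (ρ : State H) : Prop :=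
  ∀ A : H →L[ℂ] H, 0 ≤ A → trace (ρ.op * A) = 0 → A = 0

variable (H)

/-- A positive operator valued measure on the measurable space `Ω`: for every state `ρ`,
`X ↦ tr[ρ M(X)]` is a probability measure. Only the values on measurable sets matter. -/
structure POVM (Ω : Type*) [MeasurableSpace Ω] where
  effect : Set Ω → (H →L[ℂ] H)
  exists_probability : ∀ ρ : State H, ∃ μ : Measure Ω, IsProbabilityMeasure μ ∧
    ∀ X, MeasurableSet X → trace (ρ.op * effect X) = ((μ.real X : ℝ) : ℂ)

variable {H}

/-- The outcome distribution `tr[ρ M(·)]` of the POVM `M` in the state `ρ`. -/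
def POVM.law {Ω : Type*} [MeasurableSpace Ω] (M : POVM H Ω) (ρ : State H) : Measure Ω :=
  Classical.choose (M.exists_probability ρ)

instance POVM.isProbabilityMeasure_law {Ω : Type*} [MeasurableSpace Ω] (M : POVM H Ω)
    (ρ : State H) : IsProbabilityMeasure (M.law ρ) :=
  (Classical.choose_spec (M.exists_probability ρ)).1

theorem POVM.trace_effect {Ω : Type*} [MeasurableSpace Ω] (M : POVM H Ω) (ρ : State H)
    {X : Set Ω} (hX : MeasurableSet X) :
    trace (ρ.op * M.effect X) = (((M.law ρ).real X : ℝ) : ℂ) :=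
  (Classical.choose_spec (M.exists_probability ρ)).2 X hX

variable (H)

/-- A measurement (observable): a POVM on a standard Borel space of outcomes. -/
structure Observable where
  Outcome : Type
  [measurableSpace : MeasurableSpace Outcome]
  [standardBorel : StandardBorelSpace Outcome]
  povm : POVM H Outcome

attribute [instance] Observable.measurableSpace Observable.standardBorel

variable {H}

/-- The set `E(ℳ)` of effects of a set of measurements: the union of the ranges. -/
def effectsOf (ℳ : Set (Observable H)) : Set (H →L[ℂ] H) :=
  {E | ∃ M ∈ ℳ, ∃ X : Set M.Outcome, MeasurableSet X ∧ M.povm.effect X = E}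

variable (H)

/-- The set of all effects `0 ≤ E ≤ I`. -/
def allEffects : Set (H →L[ℂ] H) := {E | 0 ≤ E ∧ E ≤ 1}

variable {H}

/-- A `G`-measurement response, relative to the state `ρ₀`: a positive unital linear map
`T : L(H) → L^∞(Ω, tr[ρ₀ G])`. -/
structure MeasurementResponse (G : Observable H) (ρ₀ : State H) where
  toLinearMap : (H →L[ℂ] H) →ₗ[ℂ] Lp ℂ ∞ (G.povm.law ρ₀)
  positive : ∀ A, 0 ≤ A → ∀ᵐ ω ∂(G.povm.law ρ₀), 0 ≤ toLinearMap A ω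
  unital : ∀ᵐ ω ∂(G.povm.law ρ₀), toLinearMap 1 ω = 1

/-- The statistics of the states in `𝒮` and the measurements in `ℳ` have a (possibly non-normal)
noncontextual model: `tr[ρ M(X)] = ∫ T(M(X)) d tr[ρ G]`. -/
def HasNonNormalModel (𝒮 : Set (State H)) (ℳ : Set (Observable H)) : Prop :=
  ∃ (G : Observable H) (ρ₀ : State H), ρ₀.Faithful ∧ ∃ T : MeasurementResponse G ρ₀,
    ∀ M ∈ ℳ, ∀ ρ ∈ 𝒮, ∀ X : Set M.Outcome, MeasurableSet X →
      trace (ρ.op * M.povm.effect X) =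
        ∫ ω, T.toLinearMap (M.povm.effect X) ω ∂(G.povm.law ρ)

/-- `Λ(A) = ∑ᵢ tr[σᵢ A] G(Xᵢ)` for states `σᵢ` and a countable measurable partition `(Xᵢ)` of the
outcome space of `G` (some `Xᵢ` may be empty, so finite partitions are included): measure `G`, and
prepare `σᵢ` if the outcome lies in `Xᵢ`. These are Heisenberg duals of entanglement breaking
channels. The series of operators is understood in the ultraweak topology. -/
def IsMeasureAndPrepare (G : Observable H) (Λ : (H →L[ℂ] H) →ₗ[ℂ] (H →L[ℂ] H)) : Prop :=
  ∃ (X : ℕ → Set G.Outcome) (σ : ℕ → State H),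
    (∀ i, MeasurableSet (X i)) ∧ Pairwise (fun i j => Disjoint (X i) (X j)) ∧
    (⋃ i, X i) = Set.univ ∧
    ∀ (ρ : State H) (A : H →L[ℂ] H),
      HasSum (fun i => trace ((σ i).op * A) * trace (ρ.op * G.povm.effect (X i)))
        (trace (ρ.op * Λ A))

/-- For some fixed `G`, every finite set of effects in `ℰ` is approximately fixed, on all states
in `𝒮`, by a measure-and-prepare channel built on `G`. -/
def HasApproximateModel (𝒮 : Set (State H)) (ℰ : Set (H →L[ℂ] H)) : Prop :=
  ∃ G : Observable H, ∀ ε : ℝ, 0 < ε → ∀ F : Finset (H →L[ℂ] H), (F : Set (H →L[ℂ] H)) ⊆ ℰ →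
    ∃ Λ : (H →L[ℂ] H) →ₗ[ℂ] (H →L[ℂ] H), IsMeasureAndPrepare G Λ ∧
      ∀ ρ ∈ 𝒮, ∀ E ∈ F, ‖trace (ρ.op * (Λ E - E))‖ < ε

/-- `ℳ` is contextuality non-confirming in the non-normal sense. -/
def MeasurementsNonNormalNonConfirming (ℳ : Set (Observable H)) : Prop :=
  HasNonNormalModel Set.univ ℳ

/-- `𝒮` is contextuality non-confirming in the non-normal sense. -/
def StatesNonNormalNonConfirming (𝒮 : Set (State H)) : Prop :=
  HasNonNormalModel 𝒮 Set.univ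

/-- `ℳ` is approximately contextuality non-confirming. -/
def MeasurementsApproxNonConfirming (ℳ : Set (Observable H)) : Prop :=
  HasApproximateModel Set.univ (effectsOf ℳ)

/-- `𝒮` is approximately contextuality non-confirming. -/
def StatesApproxNonConfirming (𝒮 : Set (State H)) : Prop :=
  HasApproximateModel 𝒮 (allEffects H)

end Contextuality

end

namespace Contextuality

/-! Both parts are instances of one equivalence for a set of states and a set of effects, in which
the same POVM `G` serves both kinds of model.

From a response `T` to channels: for finitely many effects `E j`, the vector of values `T (E j) ω`
lies, for almost every `ω`, in the closure of the vectors that normal states assign to the `E j`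
(`ae_mem_closure_statistics`). Otherwise some separating half-space would contradict positivity and
unitality of `T`. These vectors form a bounded set in a finite-dimensional space, so finitely many
states approximate all of them; partitioning the outcomes according to which state is close gives
the channel.

From channels to a response: each channel is integration of `ω ↦ tr[s(ω) A]` for a state-valued
function `s`, bounded by `‖A‖`. Along an ultrafilter of finer precision and larger finite sets of
effects, these functions converge weak-* in `L^∞` of the law of a faithful `ρ₀`
(`exists_weak_limit`). Positivity and unitality are closed convex conditions, so they survive;
normality need not. Faithfulness gives every `tr[ρ G]` an `L¹` density against `tr[ρ₀ G]`, so the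
reproduced statistics pass to the limit. -/

theorem _root_.HilbertBasis.countable_index {ι E : Type*} [NormedAddCommGroup E]
    [InnerProductSpace ℂ E] [TopologicalSpace.SeparableSpace E] (b : HilbertBasis ι ℂ E) : Countable ι := by
  -- Distinct basis vectors are at distance `√2 > 1`, and a separable space has only countably many
  -- disjoint nonempty open sets.
  have hd : (Set.univ : Set ι).PairwiseDisjoint fun i => Metric.ball (b i) (1 / 2) := by
    intro i _ j _ hij
    refine Metric.ball_disjoint_ball ?_
    have h1 : ‖b i - b j‖ ^ 2 = 2 := by
      have h := norm_sub_sq (𝕜 := ℂ) (b i) (b j)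
      rw [b.orthonormal.1 i, b.orthonormal.1 j, b.orthonormal.2 hij] at h
      rw [h]
      norm_num
    rw [dist_eq_norm]
    nlinarith [norm_nonneg (b i - b j)]
  have h := hd.countable_of_isOpen (fun _ _ => Metric.isOpen_ball)
    (fun i _ => ⟨b i, Metric.mem_ball_self (by norm_num)⟩)
  exact Set.countable_univ_iff.1 h

/-! ### Normal states: functionals, vector states, mixtures, a faithful state. -/

section States

variable {H : Type*} [NormedAddCommGroup H] [InnerProductSpace ℂ H] [CompleteSpace H]

/-- A state is a countable mixture of vector functionals. -/
theorem State.exists_hasSum_inner (ρ : State H) :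
    ∃ v : BasisIndex H → H, HasSum (fun j => ‖v j‖ ^ 2) 1 ∧
      ∀ A : H →L[ℂ] H, HasSum (fun j => ⟪v j, A (v j)⟫_ℂ) (trace (ρ.op * A)) := by
  obtain ⟨S, hSa, hSS⟩ : ∃ S : H →L[ℂ] H, ContinuousLinearMap.adjoint S = S ∧ S * S = ρ.op :=
    ⟨CFC.sqrt ρ.op, (CFC.sqrt_nonneg ρ.op).isSelfAdjoint, CFC.sqrt_mul_sqrt_self _ ρ.nonneg⟩
  have hin : ∀ x y : H, ⟪x, S y⟫_ℂ = ⟪S x, y⟫_ℂ := fun x y => by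
    rw [← ContinuousLinearMap.adjoint_inner_left, hSa]
  have hone : HasSum (fun i => ‖S (basis H i)‖ ^ 2) 1 := by
    have h := Complex.hasSum_re ρ.hasSum_one
    rw [Complex.one_re] at h
    convert h using 1
    funext i
    rw [← hSS, mul_apply_eq_comp, hin, inner_self_eq_norm_sq_to_K]
    norm_cast
  have hfin : ∑' i, ENNReal.ofReal (‖S (basis H i)‖ ^ 2) ≠ ∞ := by
    rw [← ENNReal.ofReal_tsum_of_nonneg (fun _ => by positivity) hone.summable]
    exact ENNReal.ofReal_ne_top
  refine ⟨fun j => S (basis H j), hone, fun A => ?_⟩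
  have hadj : ContinuousLinearMap.adjoint (S * A) = ContinuousLinearMap.adjoint A * S := by
    have h := ContinuousLinearMap.adjoint_comp S A
    rw [hSa] at h
    exact h
  have hfinR : ∑' i, ENNReal.ofReal (‖(S * A) (basis H i)‖ ^ 2) ≠ ∞ := by
    rw [hilbertSchmidt_adjoint (basis H) (basis H), hadj]
    have hle : ∀ j, ENNReal.ofReal (‖(ContinuousLinearMap.adjoint A * S) (basis H j)‖ ^ 2) ≤
        ENNReal.ofReal (‖ContinuousLinearMap.adjoint A‖ ^ 2) *
          ENNReal.ofReal (‖S (basis H j)‖ ^ 2) := by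
      intro j
      rw [← ENNReal.ofReal_mul (by positivity), ← mul_pow]
      refine ENNReal.ofReal_le_ofReal (pow_le_pow_left₀ (norm_nonneg _) ?_ 2)
      exact (ContinuousLinearMap.adjoint A).le_opNorm _
    refine ne_top_of_le_ne_top ?_ (ENNReal.tsum_le_tsum hle)
    rw [ENNReal.tsum_mul_left]
    exact ENNReal.mul_ne_top ENNReal.ofReal_ne_top hfin
  -- Cyclicity of the trace, `tr[S (S A)] = tr[(S A) S]`, for `S = √ρ`.
  obtain ⟨h1, h2⟩ := hasSum_inner_hilbertSchmidt (basis H) (basis H) S (S * A) hfin hfinR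
  have hterm : ∀ x : H, ⟪x, (ρ.op * A) x⟫_ℂ = ⟪S x, (S * A) x⟫_ℂ := fun x => by
    rw [← hSS, mul_apply_eq_comp, mul_apply_eq_comp, hin]
    rfl
  have h3 : (fun j => ⟪S (basis H j), A (S (basis H j))⟫_ℂ) = fun j =>
      ⟪ContinuousLinearMap.adjoint (S * A) (basis H j),
        ContinuousLinearMap.adjoint S (basis H j)⟫_ℂ := by
    funext j
    rw [hadj, hSa, mul_apply_eq_comp, ContinuousLinearMap.adjoint_inner_left]
  rw [h3]
  simp_rw [trace, hterm]
  rw [h1.tsum_eq]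
  exact h2.hasSum

theorem State.trace_mul_add (ρ : State H) (A B : H →L[ℂ] H) :
    trace (ρ.op * (A + B)) = trace (ρ.op * A) + trace (ρ.op * B) := by
  obtain ⟨v, -, hv⟩ := ρ.exists_hasSum_inner
  refine (hv (A + B)).unique ?_
  simpa [inner_add_right] using (hv A).add (hv B)

theorem State.trace_mul_smul (ρ : State H) (c : ℂ) (A : H →L[ℂ] H) :
    trace (ρ.op * (c • A)) = c * trace (ρ.op * A) := by
  obtain ⟨v, -, hv⟩ := ρ.exists_hasSum_inner
  refine (hv (c • A)).unique ?_
  simpa [inner_smul_right] using (hv A).mul_left c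

/-- The normal functional `A ↦ tr[ρ A]` of a state. -/
noncomputable def State.functional (ρ : State H) : (H →L[ℂ] H) →ₗ[ℂ] ℂ where
  toFun A := trace (ρ.op * A)
  map_add' := ρ.trace_mul_add
  map_smul' := ρ.trace_mul_smul

theorem State.functional_apply (ρ : State H) (A : H →L[ℂ] H) :
    ρ.functional A = trace (ρ.op * A) := rfl

theorem State.functional_one (ρ : State H) : ρ.functional 1 = 1 := by
  rw [functional_apply, mul_one]
  exact ρ.hasSum_one.tsum_eq

theorem State.functional_nonneg (ρ : State H) {A : H →L[ℂ] H} (hA : 0 ≤ A) :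
    0 ≤ ρ.functional A := by
  obtain ⟨v, -, hv⟩ := ρ.exists_hasSum_inner
  exact (hv A).nonneg fun j =>
    ((ContinuousLinearMap.nonneg_iff_isPositive A).1 hA).inner_nonneg_right (v j)

theorem State.norm_functional_le (ρ : State H) (A : H →L[ℂ] H) : ‖ρ.functional A‖ ≤ ‖A‖ := by
  obtain ⟨v, h1, hv⟩ := ρ.exists_hasSum_inner
  have h2 : HasSum (fun j => ‖A‖ * ‖v j‖ ^ 2) ‖A‖ := by simpa using h1.mul_left ‖A‖
  refine (hv A).norm_le_of_bounded h2 fun j => ?_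
  calc ‖⟪v j, A (v j)⟫_ℂ‖ ≤ ‖v j‖ * ‖A (v j)‖ := norm_inner_le_norm _ _
    _ ≤ ‖v j‖ * (‖A‖ * ‖v j‖) := by gcongr; exact A.le_opNorm _
    _ = ‖A‖ * ‖v j‖ ^ 2 := by ring

/-- The vector state of a unit vector. -/
noncomputable def State.pure (x : H) (hx : ‖x‖ = 1) : State H where
  op := InnerProductSpace.rankOne ℂ x x
  nonneg := (ContinuousLinearMap.nonneg_iff_isPositive _).2
    (InnerProductSpace.isPositive_rankOne_self x)
  hasSum_one := by
    have h := (basis H).hasSum_inner_mul_inner x x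
    rw [inner_self_eq_norm_sq_to_K, hx] at h
    simpa [inner_smul_right] using h

theorem State.functional_pure (x : H) (hx : ‖x‖ = 1) (A : H →L[ℂ] H) :
    (State.pure x hx).functional A = ⟪x, A x⟫_ℂ := by
  refine ((State.pure x hx).hasSum_trace A (basis H)).unique ?_
  have h := (basis H).hasSum_inner_mul_inner (ContinuousLinearMap.adjoint A x) x
  rw [ContinuousLinearMap.adjoint_inner_left] at h
  simpa [State.pure, inner_smul_right, ContinuousLinearMap.adjoint_inner_left] using h

theorem nonneg_of_forall_functional_nonneg {A : H →L[ℂ] H}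
    (h : ∀ ρ : State H, 0 ≤ ρ.functional A) : 0 ≤ A := by
  rw [ContinuousLinearMap.nonneg_iff_isPositive, ContinuousLinearMap.isPositive_iff_complex]
  have key : ∀ x : H, 0 ≤ ⟪x, A x⟫_ℂ := fun x => by
    rcases eq_or_ne x 0 with rfl | hx
    · simp
    · have h1 := h (State.pure (((‖x‖ : ℂ)⁻¹) • x) (by simp [norm_smul, hx]))
      rw [State.functional_pure, map_smul, inner_smul_left, inner_smul_right] at h1
      have h2 : ⟪x, A x⟫_ℂ = ((‖x‖ ^ 2 : ℝ) : ℂ) *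
          ((starRingEnd ℂ) (‖x‖ : ℂ)⁻¹ * ((‖x‖ : ℂ)⁻¹ * ⟪x, A x⟫_ℂ)) := by
        have : (‖x‖ : ℂ) ≠ 0 := by simpa using hx
        simp only [map_inv₀, Complex.conj_ofReal, Complex.ofReal_pow]
        field_simp
      rw [h2]
      exact mul_nonneg (Complex.zero_le_real.2 (sq_nonneg _)) h1
  intro x
  have h3 := key x
  rw [← inner_conj_symm, Complex.nonneg_iff] at h3
  simp only [Complex.conj_re, Complex.conj_im] at h3
  refine ⟨?_, h3.1⟩
  apply Complex.ext
  · simp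
  · simp; linarith [h3.2]

/-- With `S = √A` the diagonal entries are `‖S eᵢ‖²`, so `S` kills every basis vector. -/
theorem eq_zero_of_forall_inner_eq_zero {A : H →L[ℂ] H} (hA : 0 ≤ A)
    (h : ∀ i, ⟪basis H i, A (basis H i)⟫_ℂ = 0) : A = 0 := by
  obtain ⟨S, hSa, hSS⟩ : ∃ S : H →L[ℂ] H, ContinuousLinearMap.adjoint S = S ∧ S * S = A :=
    ⟨CFC.sqrt A, (CFC.sqrt_nonneg A).isSelfAdjoint, CFC.sqrt_mul_sqrt_self _ hA⟩
  have hd : Dense (Submodule.span ℂ (Set.range (basis H)) : Set H) :=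
    Submodule.dense_iff_topologicalClosure_eq_top.2 (basis H).dense_span
  refine ContinuousLinearMap.ext_on hd ?_
  rintro _ ⟨i, rfl⟩
  have h1 := h i
  rw [← hSS, mul_apply_eq_comp, ← ContinuousLinearMap.adjoint_inner_left, hSa,
    inner_self_eq_zero] at h1
  rw [← hSS, mul_apply_eq_comp, h1]
  simp

/-- A diagonal operator with strictly positive summable weights works: `tr[ρ A]` is then a positive
combination of the diagonal entries of `A`. Separability enters through the countability of the
basis. -/
theorem exists_faithful_state [TopologicalSpace.SeparableSpace H] [Nontrivial H] :
    ∃ ρ : State H, ρ.Faithful := by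
  have : Countable (BasisIndex H) := (basis H).countable_index
  have hne : Nonempty (BasisIndex H) := by
    by_contra hne
    rw [not_nonempty_iff] at hne
    obtain ⟨x, hx⟩ := exists_ne (0 : H)
    refine hx ?_
    have h := (basis H).hasSum_repr x
    exact h.unique hasSum_empty
  have := Encodable.ofCountable (BasisIndex H)
  obtain ⟨f, hf0, c, hfc, -⟩ := posSumOfEncodable zero_lt_one (BasisIndex H)
  have hc : 0 < c := by
    obtain ⟨i⟩ := hne
    exact (hf0 i).trans_le (le_hasSum hfc i fun j _ => (hf0 j).le)
  set w : BasisIndex H → ℝ := fun i => f i / c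
  have hw0 : ∀ i, 0 < w i := fun i => div_pos (hf0 i) hc
  have hw1 : HasSum w 1 := by simpa [w, hc.ne'] using hfc.div_const c
  set P : BasisIndex H → (H →L[ℂ] H) := fun i =>
    (w i : ℂ) • InnerProductSpace.rankOne ℂ (basis H i) (basis H i)
  have hP0 : ∀ i, 0 ≤ P i := fun i => (ContinuousLinearMap.nonneg_iff_isPositive _).2
    ((InnerProductSpace.isPositive_rankOne_self _).smul_of_nonneg
      (Complex.zero_le_real.2 (hw0 i).le))
  have hPs : Summable P := by
    refine Summable.of_norm_bounded hw1.summable fun i => ?_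
    simp [P, norm_smul, (basis H).orthonormal.1 i, abs_of_pos (hw0 i)]
  have hPe : ∀ j, (∑' i, P i) (basis H j) = (w j : ℂ) • basis H j := fun j => by
    have h := hPs.hasSum.mapL (ContinuousLinearMap.apply ℂ H (basis H j))
    refine h.unique ?_
    convert hasSum_single j ?_ using 1
    · simp [P, (basis H).orthonormal.1 j, inner_self_eq_norm_sq_to_K]
    · intro i hij
      simp [P, (basis H).orthonormal.2 hij]
  let ρ : State H :=
    { op := ∑' i, P i
      nonneg := hPs.hasSum.nonneg hP0
      hasSum_one := by
        have h := Complex.hasSum_ofReal.2 hw1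
        simp_rw [hPe]
        simpa [inner_smul_right, inner_self_eq_norm_sq_to_K, (basis H).orthonormal.1] using h }
  refine ⟨ρ, fun A hA htr => eq_zero_of_forall_inner_eq_zero hA fun i => ?_⟩
  have h := ρ.hasSum_trace A (basis H)
  have hsa : ContinuousLinearMap.adjoint ρ.op = ρ.op :=
    ((ContinuousLinearMap.nonneg_iff_isPositive _).1 ρ.nonneg).isSelfAdjoint
  have hterm : ∀ j, ⟪basis H j, (ρ.op * A) (basis H j)⟫_ℂ =
      (w j : ℂ) * ⟪basis H j, A (basis H j)⟫_ℂ := fun j => by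
    rw [mul_apply_eq_comp, ← hsa, ContinuousLinearMap.adjoint_inner_right]
    change ⟪(∑' i, P i) (basis H j), _⟫_ℂ = _
    rw [hPe, inner_smul_left, Complex.conj_ofReal]
  simp_rw [hterm, htr] at h
  have h0 := (hasSum_zero_iff_of_nonneg fun j => mul_nonneg (Complex.zero_le_real.2 (hw0 j).le)
    (((ContinuousLinearMap.nonneg_iff_isPositive A).1 hA).inner_nonneg_right (basis H j))).1 h
  have := congrFun h0 i
  simpa [(hw0 i).ne'] using this

/-- Convex combinations of states. -/
noncomputable def State.mix (σ τ : State H) {a b : ℝ} (ha : 0 ≤ a) (hb : 0 ≤ b)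
    (hab : a + b = 1) : State H where
  op := (a : ℂ) • σ.op + (b : ℂ) • τ.op
  nonneg := by
    have := σ.nonneg
    have := τ.nonneg
    simp only [ContinuousLinearMap.nonneg_iff_isPositive] at *
    exact (ContinuousLinearMap.IsPositive.smul_of_nonneg ‹_› (Complex.zero_le_real.2 ha)).add
      (ContinuousLinearMap.IsPositive.smul_of_nonneg ‹_› (Complex.zero_le_real.2 hb))
  hasSum_one := by
    have h := (σ.hasSum_one.mul_left (a : ℂ)).add (τ.hasSum_one.mul_left (b : ℂ))
    rw [mul_one, mul_one, ← Complex.ofReal_add, hab, Complex.ofReal_one] at h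
    simpa [inner_add_right, inner_smul_right] using h

theorem State.functional_mix (σ τ : State H) {a b : ℝ} (ha : 0 ≤ a) (hb : 0 ≤ b)
    (hab : a + b = 1) (A : H →L[ℂ] H) :
    (σ.mix τ ha hb hab).functional A = a * σ.functional A + b * τ.functional A := by
  refine ((σ.mix τ ha hb hab).hasSum_trace A (basis H)).unique ?_
  have h := ((σ.hasSum_trace A (basis H)).mul_left (a : ℂ)).add
    ((τ.hasSum_trace A (basis H)).mul_left (b : ℂ))
  simpa [State.mix, inner_add_right, inner_smul_right, State.functional_apply] using h

theorem State.functional_eq_re (ρ : State H) {A : H →L[ℂ] H} (hA : 0 ≤ A) :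
    ρ.functional A = ((ρ.functional A).re : ℂ) :=
  (Complex.eq_re_of_ofReal_le (r := 0) (by simpa using ρ.functional_nonneg hA))

end States

/-! ### Effects of POVMs and absolute continuity of their laws. -/

section Effects

variable {H : Type*} [NormedAddCommGroup H] [InnerProductSpace ℂ H] [CompleteSpace H]
  {Ω : Type*} [MeasurableSpace Ω]

theorem POVM.functional_effect (M : POVM H Ω) (ρ : State H) {X : Set Ω} (hX : MeasurableSet X) :
    ρ.functional (M.effect X) = (((M.law ρ).real X : ℝ) : ℂ) :=
  M.trace_effect ρ hX

theorem POVM.effect_mem_allEffects (M : POVM H Ω) {X : Set Ω} (hX : MeasurableSet X) :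
    M.effect X ∈ allEffects H := by
  constructor
  · refine nonneg_of_forall_functional_nonneg fun ρ => ?_
    rw [M.functional_effect ρ hX]
    exact Complex.zero_le_real.2 measureReal_nonneg
  · rw [← sub_nonneg]
    refine nonneg_of_forall_functional_nonneg fun ρ => ?_
    rw [map_sub, M.functional_effect ρ hX, ρ.functional_one, sub_nonneg]
    exact_mod_cast measureReal_le_one

/-- A null set for `ρ₀` has zero effect by faithfulness, hence is null for every state. -/
theorem POVM.law_absolutelyContinuous (M : POVM H Ω) {ρ₀ : State H} (h₀ : ρ₀.Faithful)
    (ρ : State H) : M.law ρ ≪ M.law ρ₀ := by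
  refine Measure.AbsolutelyContinuous.mk fun X hX h => ?_
  have h1 : M.effect X = 0 := h₀ _ (M.effect_mem_allEffects hX).1 (by
    rw [M.trace_effect ρ₀ hX, measureReal_def, h]
    simp)
  have h2 := M.functional_effect ρ hX
  rw [h1, map_zero, eq_comm, Complex.ofReal_eq_zero] at h2
  exact (measureReal_eq_zero_iff).1 h2

/-- The two-outcome POVM with effects `E` and `1 - E`. -/
theorem exists_observable_of_effect {E : H →L[ℂ] H} (hE : E ∈ allEffects H) :
    ∃ (M : Observable H) (X : Set M.Outcome), MeasurableSet X ∧ M.povm.effect X = E := by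
  classical
  have hE' : 0 ≤ 1 - E := sub_nonneg.2 hE.2
  let G : POVM H Bool :=
    { effect := fun X => (if true ∈ X then E else 0) + (if false ∈ X then 1 - E else 0)
      exists_probability := fun ρ => by
        have h1 := ρ.functional_eq_re hE.1
        have h2 := ρ.functional_eq_re hE'
        have p1 : 0 ≤ (ρ.functional E).re := (Complex.nonneg_iff.1 (ρ.functional_nonneg hE.1)).1
        have p2 : 0 ≤ (ρ.functional (1 - E)).re :=
          (Complex.nonneg_iff.1 (ρ.functional_nonneg hE')).1
        have hs : (ρ.functional E).re + (ρ.functional (1 - E)).re = 1 := by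
          rw [← Complex.add_re, ← map_add, add_sub_cancel, ρ.functional_one, Complex.one_re]
        refine ⟨ENNReal.ofReal (ρ.functional E).re • Measure.dirac true +
          ENNReal.ofReal (ρ.functional (1 - E)).re • Measure.dirac false, ⟨?_⟩, fun X _ => ?_⟩
        · simp [-map_sub, ← ENNReal.ofReal_add p1 p2, hs]
        · rw [← ρ.functional_apply, map_add, measureReal_def]
          by_cases ht : true ∈ X <;> by_cases hf : false ∈ X <;>
            simp [-map_sub, ht, hf, ENNReal.toReal_add, p1, p2, ← h1, ← h2] }
  exact ⟨{ Outcome := Bool, povm := G }, {true}, MeasurableSet.of_discrete, by simp [G]⟩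

end Effects

/-! ### From a response map to measure-and-prepare channels. -/

section ApproximateFromResponse

variable {H : Type*} [NormedAddCommGroup H] [InnerProductSpace ℂ H] [CompleteSpace H]

theorem nonempty_state [Nontrivial H] : Nonempty (State H) := by
  obtain ⟨x, hx⟩ := exists_norm_eq H zero_le_one
  exact ⟨State.pure x hx⟩

/-- The joint statistics of finitely many effects over all normal states. -/
def statistics {ι : Type*} (E : ι → (H →L[ℂ] H)) : Set (ι → ℝ) :=
  Set.range fun (σ : State H) j => (σ.functional (E j)).re

theorem convex_statistics {ι : Type*} (E : ι → (H →L[ℂ] H)) : Convex ℝ (statistics E) := by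
  rintro _ ⟨σ, rfl⟩ _ ⟨τ, rfl⟩ a b ha hb hab
  exact ⟨σ.mix τ ha hb hab, by ext j; simp [State.functional_mix]⟩

theorem totallyBounded_statistics {ι : Type*} [Fintype ι] (E : ι → (H →L[ℂ] H)) :
    TotallyBounded (statistics E) := by
  refine (isCompact_closedBall (0 : ι → ℝ) (∑ j, ‖E j‖)).totallyBounded.subset ?_
  rintro _ ⟨σ, rfl⟩
  rw [mem_closedBall_zero_iff, pi_norm_le_iff_of_nonneg (by positivity)]
  intro j
  exact ((Complex.abs_re_le_norm _).trans (σ.norm_functional_le _)).trans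
    (Finset.single_le_sum (f := fun j => ‖E j‖) (fun _ _ => norm_nonneg _) (Finset.mem_univ j))

variable {G : Observable H} {ρ₀ : State H} (T : MeasurementResponse G ρ₀)

/-- The hypothesis says `c • 1 - B ≥ 0`, and `T` is positive and unital. -/
theorem MeasurementResponse.ae_le_of_forall_functional_le {B : H →L[ℂ] H} {c : ℝ}
    (hB : IsSelfAdjoint B) (h : ∀ σ : State H, (σ.functional B).re ≤ c) :
    ∀ᵐ ω ∂(G.povm.law ρ₀), (T.toLinearMap B ω).re ≤ c := by
  have h0 : 0 ≤ (c : ℂ) • (1 : H →L[ℂ] H) - B := by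
    refine nonneg_of_forall_functional_nonneg fun ρ => ?_
    have him : (ρ.functional B).im = 0 := by
      obtain ⟨v, -, hv⟩ := ρ.exists_hasSum_inner
      have h1 := Complex.hasSum_im (hv B)
      have h2 : ∀ j, (⟪v j, B (v j)⟫_ℂ).im = 0 := fun j => hB.isSymmetric.im_inner_self_apply (v j)
      simp_rw [h2] at h1
      exact h1.unique hasSum_zero
    rw [map_sub, map_smul, ρ.functional_one, Complex.nonneg_iff]
    simp [him, h ρ]
  filter_upwards [T.positive _ h0, T.unital, Lp.coeFn_sub (T.toLinearMap ((c : ℂ) • 1))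
    (T.toLinearMap B), Lp.coeFn_smul (c : ℂ) (T.toLinearMap 1)] with ω h1 h2 h3 h4
  rw [map_sub, h3, map_smul, Pi.sub_apply, h4, Pi.smul_apply, h2, Complex.nonneg_iff] at h1
  simpa using h1.1

/-- A closed convex set in a finite-dimensional space is a countable intersection of half-spaces, so
one may argue for each half-space separately and discard countably many null sets. A half-space
inequality for all states is a bound on one self-adjoint combination of the `E j`, which `T`
preserves. -/
theorem MeasurementResponse.ae_mem_closure_statistics {ι : Type*} [Fintype ι]
    {E : ι → (H →L[ℂ] H)} (hE : ∀ j, IsSelfAdjoint (E j)) :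
    ∀ᵐ ω ∂(G.povm.law ρ₀), (fun j => (T.toLinearMap (E j) ω).re) ∈ closure (statistics E) := by
  classical
  obtain ⟨l, c, hlc⟩ := RCLike.iInter_countable_halfSpaces_eq (𝕜 := ℝ)
    (convex_statistics E).closure isClosed_closure
  have hlin : ∀ (n : ℕ) (x : ι → ℝ), l n x = ∑ j, x j * l n (Pi.single j 1) := fun n x => by
    conv_lhs => rw [pi_eq_sum_univ' x, map_sum]
    simp
  have hn : ∀ n, ∀ᵐ ω ∂(G.povm.law ρ₀), l n (fun j => (T.toLinearMap (E j) ω).re) ≤ c n := by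
    intro n
    set B : H →L[ℂ] H := ∑ j, ((l n (Pi.single j 1) : ℝ) : ℂ) • E j with hBdef
    have hB : IsSelfAdjoint B :=
      isSelfAdjoint_sum _ fun j _ => IsSelfAdjoint.smul (show IsSelfAdjoint ((_ : ℝ) : ℂ) from Complex.conj_ofReal _) (hE j)
    have hle : ∀ σ : State H, (σ.functional B).re ≤ c n := fun σ => by
      have h1 : (fun j => (σ.functional (E j)).re) ∈ ⋂ n, {x | RCLike.re (l n x) ≤ c n} := by
        rw [hlc]
        exact subset_closure ⟨σ, rfl⟩
      have h2 := Set.mem_iInter.1 h1 n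
      rw [Set.mem_ofPred_eq, RCLike.re_to_real, hlin n] at h2
      simpa [hBdef, mul_comm] using h2
    have hTB : ∀ᵐ ω ∂(G.povm.law ρ₀), T.toLinearMap B ω =
        ∑ j, ((l n (Pi.single j 1) : ℝ) : ℂ) * T.toLinearMap (E j) ω := by
      have h3 : ∀ᵐ ω ∂(G.povm.law ρ₀), ∀ j, (((l n (Pi.single j 1) : ℝ) : ℂ) •
          T.toLinearMap (E j) : Lp ℂ ∞ (G.povm.law ρ₀)) ω =
            ((l n (Pi.single j 1) : ℝ) : ℂ) * T.toLinearMap (E j) ω :=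
        ae_all_iff.2 fun j => Lp.coeFn_smul _ _
      filter_upwards [h3, Lp.coeFn_finsetSum Finset.univ fun j =>
        ((l n (Pi.single j 1) : ℝ) : ℂ) • T.toLinearMap (E j)] with ω h3 h4
      rw [hBdef, map_sum]
      simp only [map_smul]
      rw [h4, Finset.sum_apply]
      exact Finset.sum_congr rfl fun j _ => h3 j
    filter_upwards [T.ae_le_of_forall_functional_le hB hle, hTB] with ω h1 h2
    rw [h2] at h1
    rw [hlin]
    simpa [mul_comm] using h1
  filter_upwards [ae_all_iff.2 hn] with ω hω
  rw [← hlc]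
  exact Set.mem_iInter.2 fun n => hω n

theorem MeasurementResponse.ae_real {A : H →L[ℂ] H} (hA : 0 ≤ A) :
    ∀ᵐ ω ∂(G.povm.law ρ₀), T.toLinearMap A ω = ((T.toLinearMap A ω).re : ℂ) := by
  filter_upwards [T.positive A hA] with ω hω
  exact Complex.eq_re_of_ofReal_le (r := 0) (by simpa using hω)

/-- The measure-and-prepare map with finitely many preparations. -/
noncomputable def measureAndPrepare (G : Observable H) {n : ℕ} (X : Fin n → Set G.Outcome)
    (σ : Fin n → State H) : (H →L[ℂ] H) →ₗ[ℂ] (H →L[ℂ] H) :=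
  ∑ i, (σ i).functional.smulRight (G.povm.effect (X i))

theorem functional_measureAndPrepare (G : Observable H) {n : ℕ} (X : Fin n → Set G.Outcome)
    (σ : Fin n → State H) (ρ : State H) (A : H →L[ℂ] H) :
    ρ.functional (measureAndPrepare G X σ A) =
      ∑ i, (σ i).functional A * ρ.functional (G.povm.effect (X i)) := by
  simp [measureAndPrepare]

theorem isMeasureAndPrepare_measureAndPrepare [Nontrivial H] (G : Observable H) {n : ℕ}
    {X : Fin n → Set G.Outcome} (hX : ∀ i, MeasurableSet (X i))
    (hd : Pairwise fun i j => Disjoint (X i) (X j)) (hu : (⋃ i, X i) = Set.univ)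
    (σ : Fin n → State H) : IsMeasureAndPrepare G (measureAndPrepare G X σ) := by
  classical
  obtain ⟨τ⟩ := nonempty_state (H := H)
  -- Beyond `n` the partition is padded with empty sets, whose effect has zero trace in every state;
  -- the state `τ` there is arbitrary.
  refine ⟨fun i => if h : i < n then X ⟨i, h⟩ else ∅, fun i => if h : i < n then σ ⟨i, h⟩ else τ,
    fun i => ?_, fun i j hij => ?_, ?_, fun ρ A => ?_⟩
  · dsimp only
    split_ifs
    exacts [hX _, MeasurableSet.empty]
  · dsimp only
    split_ifs
    · exact hd (by simpa using hij)
    all_goals simp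
  · rw [Set.eq_univ_iff_forall] at hu ⊢
    intro ω
    obtain ⟨i, hi⟩ := Set.mem_iUnion.1 (hu ω)
    exact Set.mem_iUnion.2 ⟨i, by simpa using hi⟩
  · have h0 : ∀ i ∉ (Finset.univ : Finset (Fin n)).map Fin.valEmbedding,
        trace ((if h : i < n then σ ⟨i, h⟩ else τ).op * A) *
          trace (ρ.op * G.povm.effect (if h : i < n then X ⟨i, h⟩ else ∅)) = 0 := fun i hi => by
      have hi' : ¬ i < n := fun h => hi (by simpa using h)
      rw [dif_neg hi', dif_neg hi', ← ρ.functional_apply,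
        G.povm.functional_effect ρ MeasurableSet.empty]
      simp
    have h1 := hasSum_sum_of_ne_finset_zero (L := .unconditional ℕ) h0
    rw [Finset.sum_map] at h1
    rw [← ρ.functional_apply, functional_measureAndPrepare]
    simpa [State.functional_apply] using h1

theorem HasNonNormalModel.hasApproximateModel [Nontrivial H] {𝒮 : Set (State H)}
    {ℳ : Set (Observable H)} (h : HasNonNormalModel 𝒮 ℳ) :
    HasApproximateModel 𝒮 (effectsOf ℳ) := by
  classical
  obtain ⟨G, ρ₀, hρ₀, T, hT⟩ := h
  refine ⟨G, fun ε hε F hF => ?_⟩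
  set E : F → (H →L[ℂ] H) := fun j => j.1
  have hE : ∀ j, E j ∈ effectsOf ℳ := fun j => hF j.2
  have hE0 : ∀ j, 0 ≤ E j := fun j => by
    obtain ⟨M, -, X, hX, h⟩ := hE j
    rw [← h]
    exact (M.povm.effect_mem_allEffects hX).1
  obtain ⟨t, ht, htf, hcov⟩ := Metric.finite_approx_of_totallyBounded
    (totallyBounded_statistics E) (ε / 2) (half_pos hε)
  obtain ⟨n, p, -, rfl⟩ := htf.fin_param
  choose σ hσ using fun i => ht (Set.mem_range_self i)
  have hcov' : closure (statistics E) ⊆ ⋃ i, Metric.closedBall (p i) (ε / 2) := by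
    refine closure_minimal (hcov.trans ?_) (isClosed_iUnion_of_finite fun _ =>
      Metric.isClosed_closedBall)
    rw [Set.biUnion_range]
    exact Set.iUnion_mono fun i => Metric.ball_subset_closedBall
  set v : G.Outcome → F → ℝ := fun ω j => (T.toLinearMap (E j) ω).re
  have hv : Measurable v := measurable_pi_lambda _ fun j =>
    Complex.measurable_re.comp (Lp.stronglyMeasurable _).measurable
  obtain ⟨τ₀⟩ := nonempty_state (H := H)
  have hn : 0 < n := by
    obtain ⟨i, -⟩ := Set.mem_iUnion.1 (hcov' (subset_closure ⟨τ₀, rfl⟩))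
    exact i.pos
  -- The outcomes missed by all balls form a null set for `tr[ρ₀ G]`; adding it to each `Y i` makes
  -- the `Y i` cover everything, and the `X i` below make them disjoint by least index.
  set Y : Fin n → Set G.Outcome := fun i =>
    {ω | v ω ∈ Metric.closedBall (p i) (ε / 2)} ∪ (⋃ k, {ω | v ω ∈ Metric.closedBall (p k) (ε / 2)})ᶜ
    with hYdef
  have hYm : ∀ i, MeasurableSet (Y i) := fun i =>
    (hv Metric.isClosed_closedBall.measurableSet).union
      (MeasurableSet.iUnion fun k => hv Metric.isClosed_closedBall.measurableSet).compl
  have hYu : ∀ ω, ∃ i, ω ∈ Y i := fun ω => by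
    by_cases h : ω ∈ ⋃ k, {ω | v ω ∈ Metric.closedBall (p k) (ε / 2)}
    · obtain ⟨i, hi⟩ := Set.mem_iUnion.1 h
      exact ⟨i, Or.inl hi⟩
    · exact ⟨⟨0, hn⟩, Or.inr h⟩
  set X : Fin n → Set G.Outcome := fun i => Y i ∩ ⋂ k, ⋂ (_ : k < i), (Y k)ᶜ with hXdef
  have hXm : ∀ i, MeasurableSet (X i) := fun i => (hYm i).inter
    (MeasurableSet.iInter fun k => MeasurableSet.iInter fun _ => (hYm k).compl)
  have hXd : Pairwise fun i j => Disjoint (X i) (X j) := by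
    have key : ∀ i j, i < j → Disjoint (X i) (X j) := fun i j hij =>
      Set.disjoint_left.2 fun ω hi hj => (Set.mem_iInter₂.1 hj.2 i hij) hi.1
    intro i j hij
    rcases lt_or_gt_of_ne hij with h | h
    exacts [key i j h, (key j i h).symm]
  have hXu : (⋃ i, X i) = Set.univ := by
    refine Set.eq_univ_of_forall fun ω => ?_
    obtain ⟨i, hi, hmin⟩ := WellFounded.has_min (wellFounded_lt (α := Fin n)) {i | ω ∈ Y i} (hYu ω)
    exact Set.mem_iUnion.2 ⟨i, hi, Set.mem_iInter₂.2 fun k hk hkY => hmin k hkY hk⟩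
  refine ⟨measureAndPrepare G X σ, isMeasureAndPrepare_measureAndPrepare G hXm hXd hXu σ,
    fun ρ hρ A hA => ?_⟩
  obtain ⟨j, rfl⟩ : ∃ j, E j = A := ⟨⟨A, hA⟩, rfl⟩
  set f : G.Outcome → ℂ := fun ω => ∑ i, (X i).indicator (fun _ => (σ i).functional (E j)) ω
  have hfi : Integrable f (G.povm.law ρ) := integrable_finsetSum _ fun i _ =>
    (integrable_const _).indicator (hXm i)
  have hf : ∫ ω, f ω ∂(G.povm.law ρ) = ρ.functional (measureAndPrepare G X σ (E j)) := by
    rw [functional_measureAndPrepare, integral_finsetSum _ fun i _ =>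
      (integrable_const _).indicator (hXm i)]
    refine Finset.sum_congr rfl fun i _ => ?_
    rw [integral_indicator_const _ (hXm i), G.povm.functional_effect ρ (hXm i), mul_comm]
    simp
  have hae : ∀ᵐ ω ∂(G.povm.law ρ), ‖f ω - T.toLinearMap (E j) ω‖ ≤ ε / 2 := by
    refine (G.povm.law_absolutelyContinuous hρ₀ ρ).ae_le ?_
    filter_upwards [T.ae_real (hE0 j),
      T.ae_mem_closure_statistics (fun k => (hE0 k).isSelfAdjoint)] with ω h1 h2
    obtain ⟨i, hi⟩ := Set.mem_iUnion.1 (hXu ▸ Set.mem_univ ω : ω ∈ ⋃ i, X i)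
    have hfω : f ω = (σ i).functional (E j) := by
      simp only [f]
      rw [Finset.sum_eq_single i, Set.indicator_of_mem hi]
      · intro k _ hk
        exact Set.indicator_of_notMem (Set.disjoint_right.1 (hXd hk) hi) _
      · simp
    have h3 : v ω ∈ Metric.closedBall (p i) (ε / 2) := by
      refine hi.1.resolve_right fun h => h ?_
      simpa using hcov' h2
    have h4 : |v ω j - p i j| ≤ ε / 2 := (dist_le_pi_dist (v ω) (p i) j).trans h3
    rw [hfω, (σ i).functional_eq_re (hE0 j), h1, ← Complex.ofReal_sub, Complex.norm_real,
      Real.norm_eq_abs, abs_sub_comm]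
    rw [← hσ i] at h4
    exact h4
  -- `T (E j)` is only known to lie in `L^∞` of the law of `ρ₀`; its integrability for the law of
  -- `ρ` comes from its bounded distance to `f`.
  have hdi : Integrable (fun ω => f ω - T.toLinearMap (E j) ω) (G.povm.law ρ) :=
    Integrable.of_bound (hfi.1.sub (Lp.stronglyMeasurable _).aestronglyMeasurable) (ε / 2) hae
  have hTi : Integrable (fun ω => T.toLinearMap (E j) ω) (G.povm.law ρ) := by
    simpa [Pi.sub_def] using hfi.sub hdi
  obtain ⟨M, hM, Z, hZ, hMZ⟩ := hE j
  have hmodel := hT M hM ρ hρ Z hZ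
  rw [hMZ] at hmodel
  rw [← ρ.functional_apply, map_sub, ← hf, ρ.functional_apply, hmodel, ← integral_sub hfi hTi]
  refine (norm_integral_le_of_norm_le_const hae).trans_lt ?_
  simp only [probReal_univ, mul_one]
  exact half_lt_self hε

end ApproximateFromResponse

/-! ### Weak-* compactness in `L^∞` of a finite measure. -/

section WeakLimits

open Filter Topology

/-- Averages control each of the countably many half-spaces cutting out `C`: an affine inequality
for all set averages holds almost everywhere. -/
theorem ae_mem_of_forall_setAverage_mem {Ω E : Type*} [MeasurableSpace Ω] {μ : Measure Ω}
    [IsFiniteMeasure μ] [NormedAddCommGroup E] [NormedSpace ℝ E] [CompleteSpace E]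
    [SecondCountableTopology E] {C : Set E} (hC : Convex ℝ C) (hCc : IsClosed C) {f : Ω → E}
    (hf : Integrable f μ) (h : ∀ X, MeasurableSet X → μ X ≠ 0 → (⨍ ω in X, f ω ∂μ) ∈ C) :
    ∀ᵐ ω ∂μ, f ω ∈ C := by
  obtain ⟨l, c, hlc⟩ := RCLike.iInter_countable_halfSpaces_eq (𝕜 := ℝ) hC hCc
  have hn : ∀ n, ∀ᵐ ω ∂μ, l n (f ω) ≤ c n := fun n => by
    refine ae_le_of_forall_setIntegral_le (f := fun ω => l n (f ω)) (g := fun _ => c n)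
      ((l n).integrable_comp hf) (integrable_const _) fun X hX _ => ?_
    rw [setIntegral_const, (l n).integral_comp_comm hf.integrableOn, smul_eq_mul]
    rcases eq_or_ne (μ X) 0 with h0 | h0
    · rw [setIntegral_measure_zero _ h0, map_zero, measureReal_def, h0]
      simp
    · have h1 := h X hX h0
      rw [← hlc] at h1
      have h2 := Set.mem_iInter.1 h1 n
      rw [Set.mem_ofPred_eq, RCLike.re_to_real, setAverage_eq, map_smul, smul_eq_mul] at h2
      have h3 : 0 < μ.real X := ENNReal.toReal_pos h0 (measure_ne_top _ _)
      rwa [inv_mul_le_iff₀ h3] at h2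
  filter_upwards [ae_all_iff.2 hn] with ω hω
  rw [← hlc]
  exact Set.mem_iInter.2 fun n => hω n

variable {Ω : Type*} [MeasurableSpace Ω] {μ : Measure Ω} [IsFiniteMeasure μ]

/-- Bounded functionals on `L¹` of a finite measure are given by bounded functions. -/
theorem exists_memLp_top_of_dual_L1 (φ : StrongDual ℂ (Lp ℂ 1 μ)) :
    ∃ g : Ω → ℂ, MemLp g ∞ μ ∧ ∀ h : Lp ℂ 1 μ, φ h = ∫ ω, g ω * h ω ∂μ := by
  have hone : MemLp (fun _ : Ω => (1 : ℂ)) 2 μ := memLp_const 1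
  -- On a finite measure `L²` embeds in `L¹` (here as multiplication by `1`), so the Riesz theorem
  -- in `L²` produces the density.
  let ι : Lp ℂ 2 μ →L[ℂ] Lp ℂ 1 μ := (ContinuousLinearMap.mul ℂ ℂ).holderL μ 2 2 1 hone.toLp
  have hι : ∀ h : Lp ℂ 2 μ, ι h =ᵐ[μ] h := fun h => by
    filter_upwards [(ContinuousLinearMap.mul ℂ ℂ).coeFn_holder (r := 1) (hone.toLp) h,
      hone.coeFn_toLp] with ω h1 h2
    refine h1.trans ?_
    rw [h2]
    simp
  let k : Lp ℂ 2 μ := (InnerProductSpace.toDual ℂ (Lp ℂ 2 μ)).symm (φ.comp ι)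
  let g : Ω → ℂ := fun ω => (starRingEnd ℂ) (k ω)
  have hg2 : MemLp g 2 μ := (Lp.memLp k).star
  have hgi : Integrable g μ := hg2.integrable one_le_two
  have hind : ∀ (c : ℂ) {X : Set Ω} (hX : MeasurableSet X),
      φ (indicatorConstLp 1 hX (measure_ne_top μ X) c) = ∫ ω in X, g ω * c ∂μ := by
    intro c X hX
    have h1 : ι (indicatorConstLp 2 hX (measure_ne_top μ X) c) =
        indicatorConstLp 1 hX (measure_ne_top μ X) c :=
      Lp.ext ((hι _).trans (indicatorConstLp_coeFn.trans indicatorConstLp_coeFn.symm))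
    have h2 : ⟪k, indicatorConstLp 2 hX (measure_ne_top μ X) c⟫_ℂ =
        φ (ι (indicatorConstLp 2 hX (measure_ne_top μ X) c)) :=
      InnerProductSpace.toDual_symm_apply
    rw [← h1, ← h2, L2.inner_def, ← integral_indicator hX]
    refine integral_congr_ae ?_
    filter_upwards [indicatorConstLp_coeFn (p := 2) (hs := hX) (hμs := measure_ne_top μ X)
      (c := c)] with ω hω
    rw [hω]
    by_cases h : ω ∈ X <;> simp [h, g, mul_comm]
  -- The average of `g` over `X` is `φ(1_X) / μ(X)`, of norm at most `‖φ‖`.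
  have hbound : ∀ᵐ ω ∂μ, g ω ∈ Metric.closedBall (0 : ℂ) ‖φ‖ := by
    refine ae_mem_of_forall_setAverage_mem (convex_closedBall _ _) Metric.isClosed_closedBall hgi
      fun X hX h0 => ?_
    have h1 := hind 1 hX
    simp only [mul_one] at h1
    have h3 : 0 < μ.real X := ENNReal.toReal_pos h0 (measure_ne_top _ _)
    rw [mem_closedBall_zero_iff, setAverage_eq, ← h1, norm_smul, norm_inv, Real.norm_eq_abs,
      abs_of_pos h3, inv_mul_le_iff₀ h3, mul_comm]
    refine (φ.le_opNorm _).trans (mul_le_mul_of_nonneg_left ?_ (norm_nonneg _))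
    rw [norm_indicatorConstLp one_ne_zero ENNReal.one_ne_top]
    simp
  have hgt : MemLp g ∞ μ := memLp_top_of_bound hg2.1 ‖φ‖ (by simpa using hbound)
  refine ⟨g, hgt, fun h => ?_⟩
  let ψ : StrongDual ℂ (Lp ℂ 1 μ) := (ContinuousLinearMap.mul ℂ ℂ).lpPairing μ ∞ 1 hgt.toLp
  have hψ : ∀ h, ψ h = ∫ ω, g ω * h ω ∂μ := fun h => by
    refine (ContinuousLinearMap.lpPairing_eq_integral _ _ _).trans (integral_congr_ae ?_)
    filter_upwards [hgt.coeFn_toLp] with ω hω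
    simp [hω]
  rw [← hψ]
  refine Lp.induction ENNReal.one_ne_top (motive := fun h => φ h = ψ h) ?_ ?_ ?_ h
  · intro c X hX hμX
    rw [Lp.simpleFunc.coe_indicatorConst, hind c hX, hψ, ← integral_indicator hX]
    refine integral_congr_ae ?_
    filter_upwards [indicatorConstLp_coeFn (p := 1) (hs := hX) (hμs := hμX.ne) (c := c)] with ω hω
    rw [hω]
    by_cases h : ω ∈ X <;> simp [h]
  · intro f g hf hg _ h1 h2
    rw [map_add, map_add, h1, h2]
  · exact isClosed_eq φ.continuous ψ.continuous

/-- Along an ultrafilter, uniformly bounded functions converge weak-* in `L^∞`. -/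
theorem exists_weak_limit {I : Type*} (U : Ultrafilter I) {f : I → Ω → ℂ}
    (hf : ∀ i, AEStronglyMeasurable (f i) μ) {K : ℝ} (hK : ∀ i ω, ‖f i ω‖ ≤ K) :
    ∃ g : Ω → ℂ, MemLp g ∞ μ ∧ ∀ h : Ω → ℂ, Integrable h μ →
      Tendsto (fun i => ∫ ω, f i ω * h ω ∂μ) U (𝓝 (∫ ω, g ω * h ω ∂μ)) := by
  have hft : ∀ i, MemLp (f i) ∞ μ := fun i => memLp_top_of_bound (hf i) K (ae_of_all _ (hK i))
  let B := ContinuousLinearMap.mul ℂ ℂ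
  let ψ : I → StrongDual ℂ (Lp ℂ 1 μ) := fun i => B.lpPairing μ ∞ 1 (hft i).toLp
  have hψ : ∀ i (h : Lp ℂ 1 μ), ψ i h = ∫ ω, f i ω * h ω ∂μ := fun i h => by
    refine (ContinuousLinearMap.lpPairing_eq_integral _ _ _).trans (integral_congr_ae ?_)
    filter_upwards [(hft i).coeFn_toLp] with ω hω
    simp [hω, B]
  have hψn : ∀ i, ‖ψ i‖ ≤ |K| := fun i => by
    refine ContinuousLinearMap.opNorm_le_bound _ (abs_nonneg K) fun h => ?_
    have hh : Integrable (fun ω => |K| * ‖h ω‖) μ := (L1.integrable_coeFn h).norm.const_mul _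
    rw [hψ, L1.norm_eq_integral_norm, ← integral_const_mul]
    refine norm_integral_le_of_norm_le hh (ae_of_all _ fun ω => ?_)
    rw [norm_mul]
    exact mul_le_mul_of_nonneg_right ((hK i ω).trans (le_abs_self K)) (norm_nonneg _)
  -- Banach–Alaoglu: the functionals stay in a weak-* compact ball, where the ultrafilter must
  -- converge.
  have hmem : ((U.map fun i => StrongDual.toWeakDual (ψ i) : Ultrafilter _) : Filter _) ≤
      𝓟 (WeakDual.toStrongDual ⁻¹' Metric.closedBall (0 : StrongDual ℂ (Lp ℂ 1 μ)) |K|) := by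
    rw [le_principal_iff]
    refine Filter.Eventually.of_forall (f := (U : Filter I)) fun i => ?_
    simpa using hψn i
  obtain ⟨φ, -, hφ⟩ := (WeakDual.isCompact_closedBall (𝕜 := ℂ)
    (0 : StrongDual ℂ (Lp ℂ 1 μ)) |K|).ultrafilter_le_nhds _ hmem
  obtain ⟨g, hg, hgφ⟩ := exists_memLp_top_of_dual_L1 (WeakDual.toStrongDual φ)
  refine ⟨g, hg, fun h hh => ?_⟩
  have h1 : Tendsto (fun i => ψ i hh.toL1) U (𝓝 (φ hh.toL1)) :=
    ((WeakDual.eval_continuous (hh.toL1 h)).tendsto φ).comp hφ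
  have h2 : ∀ k : Ω → ℂ, ∫ ω, k ω * hh.toL1 h ω ∂μ = ∫ ω, k ω * h ω ∂μ := fun k => by
    refine integral_congr_ae ?_
    filter_upwards [hh.coeFn_toL1] with ω hω
    rw [hω]
  have h3 := hgφ hh.toL1
  rw [h2] at h3
  simp_rw [hψ, h2] at h1
  rw [← h3]
  exact h1

end WeakLimits

/-! ### From measure-and-prepare channels to a response map. -/

section ResponseFromApproximate

open Filter Topology

variable {H : Type*} [NormedAddCommGroup H] [InnerProductSpace ℂ H] [CompleteSpace H]

/-- The state prepared by a measure-and-prepare map, as a function of the outcome. -/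
theorem IsMeasureAndPrepare.exists_preparation {G : Observable H}
    {Λ : (H →L[ℂ] H) →ₗ[ℂ] (H →L[ℂ] H)} (h : IsMeasureAndPrepare G Λ) :
    ∃ s : G.Outcome → State H, (∀ A, Measurable fun ω => (s ω).functional A) ∧
      ∀ (ρ : State H) A, ∫ ω, (s ω).functional A ∂(G.povm.law ρ) = ρ.functional (Λ A) := by
  obtain ⟨X, σ, hX, hd, hu, hΛ⟩ := h
  have hex : ∀ ω, ∃ n, ω ∈ X n := fun ω => Set.mem_iUnion.1 (hu ▸ Set.mem_univ ω)
  choose i hi using hex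
  have hpre : ∀ n, i ⁻¹' {n} = X n := fun n => by
    ext ω
    refine ⟨fun h => h ▸ hi ω, fun h => ?_⟩
    by_contra hne
    exact Set.disjoint_left.1 (hd hne) (hi ω) h
  have him : Measurable i := measurable_to_countable' fun n => hpre n ▸ hX n
  have hmeas : ∀ A, Measurable fun ω => (σ (i ω)).functional A := fun A =>
    (Measurable.of_discrete (f := fun n => (σ n).functional A)).comp him
  refine ⟨fun ω => σ (i ω), hmeas, fun ρ A => ?_⟩
  have hint : Integrable (fun ω => (σ (i ω)).functional A) (G.povm.law ρ) :=
    Integrable.of_bound (hmeas A).aestronglyMeasurable ‖A‖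
      (ae_of_all _ fun ω => (σ (i ω)).norm_functional_le A)
  have h1 := hasSum_integral_iUnion hX hd hint.integrableOn
  rw [hu, setIntegral_univ] at h1
  have h2 : ∀ n, ∫ ω in X n, (σ (i ω)).functional A ∂(G.povm.law ρ) =
      trace ((σ n).op * A) * trace (ρ.op * G.povm.effect (X n)) := fun n => by
    rw [setIntegral_congr_fun (g := fun _ => (σ n).functional A) (hX n), setIntegral_const,
      G.povm.trace_effect ρ (hX n), mul_comm, ← State.functional_apply, Complex.real_smul]
    intro ω hω
    have : i ω = n := by
      rw [← hpre n] at hω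
      exact hω
    simp only [this]
  simp_rw [h2] at h1
  exact h1.unique (hΛ ρ A)

theorem HasApproximateModel.hasNonNormalModel [TopologicalSpace.SeparableSpace H] [Nontrivial H]
    {𝒮 : Set (State H)} {ℰ : Set (H →L[ℂ] H)} {ℳ : Set (Observable H)}
    (h : HasApproximateModel 𝒮 ℰ) (hℳ : effectsOf ℳ ⊆ ℰ) : HasNonNormalModel 𝒮 ℳ := by
  classical
  obtain ⟨G, hG⟩ := h
  obtain ⟨ρ₀, hρ₀⟩ := exists_faithful_state (H := H)
  -- The index pairs a precision `1/(n+1)` with a finite set of effects; both improve along `atTop`.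
  choose Λ hΛ hΛε using fun i : ℕ × Finset ℰ =>
    hG (1 / ((i.1 : ℝ) + 1)) Nat.one_div_pos_of_nat (i.2.map (Function.Embedding.subtype _))
      (by simp)
  choose s hsm hs using fun i => (hΛ i).exists_preparation
  let U : Ultrafilter (ℕ × Finset ℰ) := Ultrafilter.of atTop
  have hU : (U : Filter (ℕ × Finset ℰ)) ≤ atTop := Ultrafilter.of_le _
  set μ : Measure G.Outcome := G.povm.law ρ₀ with hμ
  choose g hg hlim using fun A : H →L[ℂ] H =>
    exists_weak_limit (μ := μ) U (f := fun i ω => (s i ω).functional A)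
      (fun i => (hsm i A).aestronglyMeasurable) (fun i ω => (s i ω).norm_functional_le A)
  have hgi : ∀ A, Integrable (g A) μ := fun A => (hg A).integrable le_top
  have hfi : ∀ i A, Integrable (fun ω => (s i ω).functional A) μ := fun i A =>
    Integrable.of_bound (hsm i A).aestronglyMeasurable ‖A‖
      (ae_of_all _ fun ω => (s i ω).norm_functional_le A)
  have hset : ∀ A {X : Set G.Outcome}, MeasurableSet X →
      Tendsto (fun i => ∫ ω in X, (s i ω).functional A ∂μ) U (𝓝 (∫ ω in X, g A ω ∂μ)) := by
    intro A X hX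
    have h1 := hlim A (X.indicator fun _ => 1) ((integrable_const _).indicator hX)
    have h2 : ∀ k : G.Outcome → ℂ,
        ∫ ω, k ω * X.indicator (fun _ => 1) ω ∂μ = ∫ ω in X, k ω ∂μ := fun k => by
      rw [← integral_indicator hX]
      refine integral_congr_ae (ae_of_all _ fun ω => ?_)
      by_cases hω : ω ∈ X <;> simp [hω]
    simpa only [h2] using h1
  -- Closed convex constraints valid for all states pass to the weak limit through set averages;
  -- used below with the nonnegative cone and with `{1}`.
  have hmem : ∀ (A : H →L[ℂ] H) {C : Set ℂ}, Convex ℝ C → IsClosed C →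
      (∀ σ : State H, σ.functional A ∈ C) → ∀ᵐ ω ∂μ, g A ω ∈ C := by
    intro A C hC hCc hA
    refine ae_mem_of_forall_setAverage_mem hC hCc (hgi A) fun X hX h0 => ?_
    have h1 : Tendsto (fun i => ⨍ ω in X, (s i ω).functional A ∂μ) U (𝓝 (⨍ ω in X, g A ω ∂μ)) := by
      simp only [setAverage_eq]
      exact (hset A hX).const_smul _
    exact hCc.mem_of_tendsto h1 (Eventually.of_forall fun i =>
      hC.set_average_mem hCc h0 (measure_ne_top _ _) (ae_of_all _ fun ω => hA _)
        (hfi i A).integrableOn)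
  let T : (H →L[ℂ] H) →ₗ[ℂ] Lp ℂ ∞ μ :=
    { toFun := fun A => (hg A).toLp
      map_add' := fun A B => by
        rw [← MemLp.toLp_add, MemLp.toLp_eq_toLp_iff]
        refine Integrable.ae_eq_of_forall_setIntegral_eq _ _ (hgi _) ((hgi A).add (hgi B))
          fun X hX _ => tendsto_nhds_unique (hset (A + B) hX) ?_
        rw [integral_add' (hgi A).integrableOn (hgi B).integrableOn]
        refine ((hset A hX).add (hset B hX)).congr fun i => ?_
        rw [← integral_add (hfi i A).integrableOn (hfi i B).integrableOn]
        simp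
      map_smul' := fun c A => by
        rw [RingHom.id_apply, ← MemLp.toLp_const_smul, MemLp.toLp_eq_toLp_iff]
        refine Integrable.ae_eq_of_forall_setIntegral_eq _ _ (hgi _) ((hgi A).smul c)
          fun X hX _ => tendsto_nhds_unique (hset (c • A) hX) ?_
        simp only [Pi.smul_apply, map_smul, integral_smul]
        exact (hset A hX).const_smul c }
  have hT : ∀ A, T A =ᵐ[μ] g A := fun A => (hg A).coeFn_toLp
  refine ⟨G, ρ₀, hρ₀, ⟨T, fun A hA => ?_, ?_⟩, fun M hM ρ hρ X hX => ?_⟩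
  · filter_upwards [hT A, hmem A (convex_Ici (0 : ℂ)) isClosed_Ici
      fun σ => σ.functional_nonneg hA] with ω h1 h2
    rw [h1]
    exact h2
  · filter_upwards [hT 1, hmem 1 (convex_singleton (1 : ℂ)) isClosed_singleton
      fun σ => σ.functional_one] with ω h1 h2
    rw [h1]
    exact h2
  · set E := M.povm.effect X
    have hE : E ∈ ℰ := hℳ ⟨M, hM, X, hX, rfl⟩
    have hac : G.povm.law ρ ≪ μ := G.povm.law_absolutelyContinuous hρ₀ ρ
    -- The density of `tr[ρ G]` against `tr[ρ₀ G]` is an `L¹` test function, which turns weak-*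
    -- convergence for `ρ₀` into convergence of integrals for `ρ`.
    have hdens : ∀ k : G.Outcome → ℂ,
        ∫ ω, k ω * (((G.povm.law ρ).rnDeriv μ ω).toReal : ℂ) ∂μ = ∫ ω, k ω ∂(G.povm.law ρ) := by
      intro k
      rw [← integral_rnDeriv_smul hac]
      simp [mul_comm]
    have h1 := hlim E (fun ω => (((G.povm.law ρ).rnDeriv μ ω).toReal : ℂ))
      Measure.integrable_toReal_rnDeriv.ofReal
    simp only [hdens, hs] at h1
    have h2 : Tendsto (fun i => ρ.functional (Λ i E)) U (𝓝 (ρ.functional E)) := by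
      refine Tendsto.mono_left ?_ hU
      rw [tendsto_iff_norm_sub_tendsto_zero]
      have h3 : Tendsto (fun i : ℕ × Finset ℰ => 1 / ((i.1 : ℝ) + 1)) atTop (𝓝 0) :=
        tendsto_one_div_add_atTop_nhds_zero_nat.comp (by
          rw [← prod_atTop_atTop_eq]
          exact tendsto_fst)
      refine squeeze_zero' (Eventually.of_forall fun _ => norm_nonneg _) ?_ h3
      -- From this index on, `E` belongs to the finite set that the channel approximates.
      filter_upwards [eventually_ge_atTop ((0, {⟨E, hE⟩}) : ℕ × Finset ℰ)] with i hi
      rw [← map_sub]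
      refine (hΛε i ρ hρ E ?_).le
      have : (⟨E, hE⟩ : ℰ) ∈ i.2 := hi.2 (Finset.mem_singleton_self _)
      simpa using ⟨hE, this⟩
    change ρ.functional E = ∫ ω, T E ω ∂(G.povm.law ρ)
    rw [integral_congr_ae (hac.ae_le (hT E))]
    exact tendsto_nhds_unique h2 h1

theorem effectsOf_univ_eq : effectsOf (Set.univ : Set (Observable H)) = allEffects H := by
  refine Set.Subset.antisymm ?_ fun E hE => ?_
  · rintro _ ⟨M, -, X, hX, rfl⟩
    exact M.povm.effect_mem_allEffects hX
  · obtain ⟨M, X, hX, h⟩ := exists_observable_of_effect hE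
    exact ⟨M, Set.mem_univ M, X, hX, h⟩

end ResponseFromApproximate

end Contextuality

theorem mainTheorem1 {H : Type*} [NormedAddCommGroup H] [InnerProductSpace ℂ H] [CompleteSpace H]
    [TopologicalSpace.SeparableSpace H] [Nontrivial H] :
    (∀ ℳ : Set (Contextuality.Observable H),
      Contextuality.MeasurementsNonNormalNonConfirming ℳ ↔
        Contextuality.MeasurementsApproxNonConfirming ℳ) ∧
    (∀ 𝒮 : Set (Contextuality.State H),
      Contextuality.StatesNonNormalNonConfirming 𝒮 ↔
        Contextuality.StatesApproxNonConfirming 𝒮) := by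
  refine ⟨fun ℳ => ⟨fun h => h.hasApproximateModel, fun h => h.hasNonNormalModel subset_rfl⟩,
    fun 𝒮 => ⟨fun h => ?_, fun h => h.hasNonNormalModel Contextuality.effectsOf_univ_eq.subset⟩⟩
  have h1 := Contextuality.HasNonNormalModel.hasApproximateModel h
  rwa [Contextuality.effectsOf_univ_eq] at h1
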